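/- Let $H$ be a word hyperbolic group, that is, a group whose Cayley graph with respect to some finite generating set is Gromov hyperbolic. Let $Q$ be an infinite quasi-normal subgroup of $H$, that is, an infinite subgroup such that for every $g \in H$ the intersection $gQg^{-1} \cap Q$ has finite index in both $Q$ and $gQg^{-1}$. Let $S$ be any finite generating set of $H$, with word metric $d$ and Gromov products $(x\mid y) = \tfrac12\,(d(x,1)+d(y,1)-d(x,y))$. Then the limit set of $Q$ is the entire Gromov boundary $\partial H$ of the Cayley graph of $H$ with respect to $S$. Here $\partial H$ is the set of classes of sequences $(x_n)$ in $H$ with $(x_i \mid x_j) \to \infty$ as $i,j \to \infty$, where $(x_n)$ and $(y_n)$ are equivalent if $(x_i \mid y_j) \to \infty$ as $i,j\to\infty$, and the limit set of $Q$ is the set of all points of $\partial H$ that are represented by a sequence of elements of $Q$. -/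

import Mathlib

open Filter

namespace QuasiNormal

/-- A subgroup `Q` of a group `H` is quasi-normal if its commensurator
`{g | gQg⁻¹ ∩ Q has finite index in both gQg⁻¹ and Q}` is all of `H`. -/
def IsQuasiNormal {H : Type*} [Group H] (Q : Subgroup H) : Prop :=
  Subgroup.Commensurable.commensurator Q = ⊤

section Graph

variable {V : Type*} (Γ : SimpleGraph V)

/-- The Gromov product `(x | y)_w = (d(x,w) + d(y,w) - d(x,y)) / 2` of vertices of a graph, with
respect to the edge path metric. -/
noncomputable def gromovProduct (w x y : V) : ℝ :=
  ((Γ.dist x w : ℝ) + (Γ.dist y w : ℝ) - (Γ.dist x y : ℝ)) / 2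

/-- Gromov hyperbolicity of (the vertex set of) a connected graph: for some `δ`,
`(x | z)_w ≥ min ((x | y)_w) ((y | z)_w) - δ` for all vertices. -/
def IsGromovHyperbolic : Prop :=
  Γ.Connected ∧ ∃ δ : ℝ, ∀ w x y z : V,
    min (gromovProduct Γ w x y) (gromovProduct Γ w y z) - δ ≤ gromovProduct Γ w x z

/-- `(x_i | y_j)_w → ∞` as `i, j → ∞`. -/
def GromovDiverge (w : V) (x y : ℕ → V) : Prop :=
  Tendsto (fun p : ℕ × ℕ => gromovProduct Γ w (x p.1) (y p.2)) atTop atTop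

/-- Sequences of vertices that converge to infinity: `(x_i | x_j)_w → ∞` as `i, j → ∞`. -/
def ConvSeq (w : V) : Type _ :=
  {x : ℕ → V // GromovDiverge Γ w x x}

/-- The Gromov boundary: sequences converging to infinity, where `x` and `y` are identified if
`(x_i | y_j)_w → ∞`. On a hyperbolic graph this relation is an equivalence relation
(`gromovDiverge_equivalence` below). -/
def GromovBoundary (w : V) : Type _ :=
  Quot (fun x y : ConvSeq Γ w => GromovDiverge Γ w x.1 y.1)

/-- The boundary point to which a sequence converges. -/
def ConvSeq.lim {Γ : SimpleGraph V} {w : V} (x : ConvSeq Γ w) : GromovBoundary Γ w :=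
  Quot.mk _ x

/-- The limit set of a set `A` of vertices: all boundary points that are limits of sequences of
elements of `A`. -/
def limitSet (w : V) (A : Set V) : Set (GromovBoundary Γ w) :=
  {ξ | ∃ x : ConvSeq Γ w, (∀ n, x.1 n ∈ A) ∧ x.lim = ξ}

variable {Γ}

theorem gromovProduct_comm (w x y : V) : gromovProduct Γ w x y = gromovProduct Γ w y x := by
  unfold gromovProduct
  rw [Γ.dist_comm (u := x) (v := y)]
  ring

theorem GromovDiverge.symm {w : V} {x y : ℕ → V} (h : GromovDiverge Γ w x y) :
    GromovDiverge Γ w y x := by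
  unfold GromovDiverge at h ⊢
  rw [tendsto_atTop] at h ⊢
  intro b
  have e := h b
  rw [eventually_atTop] at e ⊢
  obtain ⟨a, ha⟩ := e
  refine ⟨(a.2, a.1), fun p hp => ?_⟩
  rw [gromovProduct_comm]
  exact ha (p.2, p.1) ⟨hp.2, hp.1⟩

theorem GromovDiverge.trans (hΓ : IsGromovHyperbolic Γ) {w : V} {x y z : ℕ → V}
    (h₁ : GromovDiverge Γ w x y) (h₂ : GromovDiverge Γ w y z) : GromovDiverge Γ w x z := by
  obtain ⟨-, δ, hδ⟩ := hΓ
  unfold GromovDiverge at h₁ h₂ ⊢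
  rw [tendsto_atTop] at h₁ h₂ ⊢
  intro b
  have e₁ := h₁ (b + δ)
  have e₂ := h₂ (b + δ)
  rw [eventually_atTop] at e₁ e₂ ⊢
  obtain ⟨a, ha⟩ := e₁
  obtain ⟨c, hc⟩ := e₂
  refine ⟨(a.1, c.2), fun p hp => ?_⟩
  have k₁ := ha (p.1, max a.2 c.1) ⟨hp.1, le_max_left _ _⟩
  have k₂ := hc (max a.2 c.1, p.2) ⟨le_max_right _ _, hp.2⟩
  have k := hδ w (x p.1) (y (max a.2 c.1)) (z p.2)
  have := le_min k₁ k₂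
  linarith

theorem gromovDiverge_equivalence (hΓ : IsGromovHyperbolic Γ) (w : V) :
    Equivalence (fun x y : ConvSeq Γ w => GromovDiverge Γ w x.1 y.1) where
  refl x := x.2
  symm h := h.symm
  trans h₁ h₂ := h₁.trans hΓ h₂

end Graph

/-- A group is word hyperbolic if its Cayley graph with respect to some finite generating set is
Gromov hyperbolic. -/
def IsWordHyperbolic (H : Type*) [Group H] : Prop :=
  ∃ S : Set H, S.Finite ∧ Subgroup.closure S = ⊤ ∧
    IsGromovHyperbolic (SimpleGraph.mulCayley S)

end QuasiNormal

/-! The key claim is that every `g` is shadowed by some `u ∈ Q`: `(g | u) ≥ |g| - B` with `B`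
independent of `g`. A sequence converging to a boundary point can then be replaced term by term by
elements of `Q` without changing its limit.

To find `u`, take a loxodromic `q ∈ Q` (`exists_isLoxodromic`). Quasi-normality puts long elements
`g q^m g⁻¹` into `Q`. The directions of `q^m` and `q^(-m)` from `1` diverge, so `g⁻¹` follows at
most one of them for long. With `r` the other one, the path from `1` via `g` and `gr` to `u = g r
g⁻¹` barely backtracks at `g`, while its last leg has length only `|g|`; hence a geodesic to `u`
starts close to one to `g`.

A loxodromic exists because otherwise every `q ∈ Q` would almost fix points far along a geodesic
towards a very long element of `Q`. Conjugating by such a point would embed arbitrarily many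
elements of `Q` in one fixed ball.

Hyperbolicity is assumed for one generating set only. It passes to `S` by stability of geodesics
under bilipschitz change of metric (`IsGromovHyperbolic.of_bilipschitz`). -/

namespace QuasiNormal

/-! ### Geodesics and Gromov products in graphs -/

section Graph

variable {V : Type*} {Γ Γ₀ : SimpleGraph V}

theorem dist_triangle_real (hΓ : Γ.Connected) (x y z : V) :
    (Γ.dist x z : ℝ) ≤ Γ.dist x y + Γ.dist y z := by
  exact_mod_cast hΓ.dist_triangle

theorem dist_comm_real (Γ : SimpleGraph V) (x y : V) : (Γ.dist x y : ℝ) = Γ.dist y x := by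
  rw [Γ.dist_comm]

theorem gromovProduct_nonneg (hΓ : Γ.Connected) (w x y : V) : 0 ≤ gromovProduct Γ w x y := by
  have := dist_triangle_real hΓ x w y
  have := dist_comm_real Γ w y
  unfold gromovProduct
  linarith

theorem gromovProduct_self (w x : V) : gromovProduct Γ w x x = Γ.dist x w := by
  unfold gromovProduct
  simp

/-- Moving the base point changes the Gromov product by at most the distance. -/
theorem gromovProduct_le_add_dist (hΓ : Γ.Connected) (w w' x y : V) :
    gromovProduct Γ w x y ≤ gromovProduct Γ w' x y + Γ.dist w w' := by
  have := dist_triangle_real hΓ x w' w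
  have := dist_triangle_real hΓ y w' w
  have := dist_comm_real Γ w w'
  unfold gromovProduct
  linarith

theorem dist_le_mul_of_adj (h₀ : Γ₀.Connected) (hΓ : Γ.Connected) {L : ℕ}
    (hL : ∀ x y, Γ.Adj x y → Γ₀.dist x y ≤ L) (x y : V) : Γ₀.dist x y ≤ L * Γ.dist x y := by
  obtain ⟨p, hp⟩ := hΓ.exists_walk_length_eq_dist x y
  rw [← hp]
  clear hp
  induction p with
  | nil => simp
  | @cons a b c h p ih =>
    have h1 := hL _ _ h
    have h2 : Γ₀.dist a c ≤ Γ₀.dist a b + Γ₀.dist b c := h₀.dist_triangle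
    rw [SimpleGraph.Walk.length_cons]
    linarith

/-- The sequence `c 0, …, c n` is a geodesic of the graph. -/
def IsGeodesic (Γ : SimpleGraph V) (c : ℕ → V) (n : ℕ) : Prop :=
  ∀ i j, i ≤ j → j ≤ n → Γ.dist (c i) (c j) = j - i

theorem exists_isGeodesic (hΓ : Γ.Connected) (x y : V) :
    ∃ c : ℕ → V, c 0 = x ∧ c (Γ.dist x y) = y ∧ IsGeodesic Γ c (Γ.dist x y) := by
  obtain ⟨p, hp⟩ := hΓ.exists_walk_length_eq_dist x y
  have h0 : p.getVert 0 = x := p.getVert_zero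
  have hn : p.getVert (Γ.dist x y) = y := by rw [← hp]; exact p.getVert_length
  refine ⟨p.getVert, h0, hn, ?_⟩
  have key : ∀ i k, i + k ≤ Γ.dist x y → Γ.dist (p.getVert i) (p.getVert (i + k)) ≤ k := by
    intro i k
    induction k with
    | zero => simp
    | succ k ih =>
      intro h
      have h1 := ih (by omega)
      have h2 : Γ.Adj (p.getVert (i + k)) (p.getVert (i + k + 1)) :=
        p.adj_getVert_succ (by omega)
      have h3 : Γ.dist (p.getVert i) (p.getVert (i + k + 1)) ≤ _ :=
        hΓ.dist_triangle (v := p.getVert (i + k))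
      rw [SimpleGraph.dist_eq_one_iff_adj.2 h2] at h3
      rw [← add_assoc]
      omega
  intro i j hij hj
  have h1 := key 0 i (by omega)
  have h2 := key i (j - i) (by omega)
  have h3 := key j (Γ.dist x y - j) (by omega)
  rw [zero_add, h0] at h1
  rw [show i + (j - i) = j by omega] at h2
  rw [show j + (Γ.dist x y - j) = Γ.dist x y by omega, hn] at h3
  have h4 : Γ.dist x y ≤ Γ.dist x (p.getVert i) + Γ.dist (p.getVert i) y := hΓ.dist_triangle
  have h5 : Γ.dist (p.getVert i) y ≤ Γ.dist (p.getVert i) (p.getVert j) + Γ.dist (p.getVert j) y :=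
    hΓ.dist_triangle
  omega

theorem IsGeodesic.dist_eq_sub {c : ℕ → V} {n : ℕ} (hc : IsGeodesic Γ c n) {i j : ℕ} (hij : i ≤ j)
    (hj : j ≤ n) : (Γ.dist (c i) (c j) : ℝ) = j - i := by
  rw [hc i j hij hj, Nat.cast_sub hij]

theorem IsGeodesic.gromovProduct_eq_zero {c : ℕ → V} {n : ℕ} (hc : IsGeodesic Γ c n) {i j k : ℕ}
    (hij : i ≤ j) (hjk : j ≤ k) (hk : k ≤ n) : gromovProduct Γ (c j) (c i) (c k) = 0 := by
  have h1 := hc.dist_eq_sub hij (hjk.trans hk)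
  have h2 := hc.dist_eq_sub hjk hk
  have h3 := hc.dist_eq_sub (hij.trans hjk) hk
  have := dist_comm_real Γ (c k) (c j)
  unfold gromovProduct
  linarith

/-! ### The four point inequality along chains -/

/-- The four point inequality with constant `δ`. -/
def FourPoint (Γ : SimpleGraph V) (δ : ℝ) : Prop :=
  ∀ w x y z : V,
    min (gromovProduct Γ w x y) (gromovProduct Γ w y z) - δ ≤ gromovProduct Γ w x z

theorem IsGromovHyperbolic.exists_fourPoint (h : IsGromovHyperbolic Γ) :
    ∃ δ, 0 ≤ δ ∧ FourPoint Γ δ := by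
  obtain ⟨-, δ, hδ⟩ := h
  exact ⟨max δ 0, le_max_right _ _, fun w x y z =>
    le_trans (sub_le_sub_left (le_max_left _ _) _) (hδ w x y z)⟩

theorem FourPoint.cases {δ : ℝ} (h : FourPoint Γ δ) (w x y z : V) :
    gromovProduct Γ w x y ≤ gromovProduct Γ w x z + δ ∨
      gromovProduct Γ w y z ≤ gromovProduct Γ w x z + δ := by
  have := h w x y z
  rcases min_choice (gromovProduct Γ w x y) (gromovProduct Γ w y z) with e | e <;> rw [e] at this
  · left; linarith
  · right; linarith

/-- Halving the chain costs one `δ` per step, so the loss is only logarithmic in its length. -/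
theorem FourPoint.exists_gromovProduct_le {δ : ℝ} (h : FourPoint Γ δ) (hδ : 0 ≤ δ) (w : V) (k : ℕ) :
    ∀ (z : ℕ → V) (n : ℕ), n ≤ 2 ^ k → 0 < n →
      ∃ i < n, gromovProduct Γ w (z i) (z (i + 1)) ≤ gromovProduct Γ w (z 0) (z n) + k * δ := by
  induction k with
  | zero =>
    intro z n hn h0
    have : n = 1 := by simp at hn; omega
    subst this
    exact ⟨0, one_pos, by simp⟩
  | succ k ih =>
    intro z n hn h0
    push_cast
    by_cases hk : n ≤ 2 ^ k
    · obtain ⟨i, hi, h1⟩ := ih z n hk h0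
      exact ⟨i, hi, by linarith⟩
    · rw [pow_succ] at hn
      rcases h.cases w (z 0) (z (2 ^ k)) (z n) with e | e
      · obtain ⟨i, hi, h1⟩ := ih z (2 ^ k) le_rfl (by positivity)
        exact ⟨i, by omega, by linarith⟩
      · obtain ⟨i, hi, h1⟩ := ih (fun j => z (2 ^ k + j)) (n - 2 ^ k) (by omega) (by omega)
        simp only [add_zero, show 2 ^ k + (n - 2 ^ k) = n by omega] at h1
        exact ⟨2 ^ k + i, by omega, by rw [add_assoc]; linarith⟩

theorem FourPoint.exists_dist_le {δ : ℝ} (h : FourPoint Γ δ) (hΓ : Γ.Connected) (hδ : 0 ≤ δ)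
    {L : ℕ} {z : ℕ → V} {n : ℕ} (hz : ∀ i < n, Γ.dist (z i) (z (i + 1)) ≤ L) (w : V) (k : ℕ)
    {i j : ℕ} (hi : i ≤ n) (hj : j ≤ n) (hij : i ≤ j) (hk : j - i ≤ 2 ^ k) :
    ∃ m ≤ n, (Γ.dist w (z m) : ℝ) ≤ gromovProduct Γ w (z i) (z j) + k * δ + L := by
  rcases hij.eq_or_lt with rfl | hlt
  · refine ⟨i, hi, ?_⟩
    rw [gromovProduct_self, dist_comm_real]
    have : 0 ≤ k * δ := by positivity
    have : (0 : ℝ) ≤ L := by positivity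
    linarith
  · obtain ⟨m, hm, h1⟩ := h.exists_gromovProduct_le hδ w k (fun s => z (i + s)) (j - i) hk (by omega)
    refine ⟨i + m, by omega, ?_⟩
    simp only [add_zero, show i + (j - i) = j by omega, ← add_assoc] at h1
    have h2 : (Γ.dist (z (i + m)) (z (i + m + 1)) : ℝ) ≤ L := by exact_mod_cast hz _ (by omega)
    have h3 := dist_triangle_real hΓ w (z (i + m + 1)) (z (i + m))
    have h4 := dist_comm_real Γ w (z (i + m))
    have h5 := dist_comm_real Γ w (z (i + m + 1))
    have h6 := dist_comm_real Γ (z (i + m)) (z (i + m + 1))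
    unfold gromovProduct at h1 ⊢
    linarith

/-! ### Stability of geodesics under bilipschitz change of metric -/

theorem exists_log_bound (A B : ℝ) (M : ℕ) (hM : 0 < M) :
    ∃ D : ℝ, ∀ R : ℕ, D < R → ∃ k : ℕ, M * R ≤ 2 ^ k ∧ A * k + B < R := by
  have h1 : Tendsto (fun k : ℕ => (M : ℝ) * A * ((k : ℝ) ^ 1 / 2 ^ k)
      + M * (A + B) * ((k : ℝ) ^ 0 / 2 ^ k)) atTop (nhds (M * A * 0 + M * (A + B) * 0)) :=
    ((tendsto_pow_const_div_const_pow_of_one_lt 1 one_lt_two).const_mul _).add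
      ((tendsto_pow_const_div_const_pow_of_one_lt 0 one_lt_two).const_mul _)
  have h2 := h1.eventually_lt_const (u := 1) (by norm_num)
  obtain ⟨k₀, hk₀⟩ := eventually_atTop.1 h2
  refine ⟨2 ^ k₀, fun R hR => ?_⟩
  have hex : ∃ k, M * R ≤ 2 ^ k := ⟨M * R, Nat.lt_two_pow_self.le⟩
  classical
  -- For the least `k`, minimality gives `2 ^ (k - 1) < M * R`, so `R` outgrows any linear function
  -- of `k`.
  refine ⟨Nat.find hex, Nat.find_spec hex, ?_⟩
  have hR' : 2 ^ k₀ < R := by exact_mod_cast hR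
  have hlt : k₀ < Nat.find hex := by
    rw [Nat.lt_find_iff]
    intro m hm hle
    have : 2 ^ m ≤ 2 ^ k₀ := Nat.pow_le_pow_right two_pos hm
    nlinarith
  obtain ⟨k, hk⟩ : ∃ k, Nat.find hex = k + 1 := ⟨Nat.find hex - 1, by omega⟩
  have hmin : ¬ M * R ≤ 2 ^ k := Nat.find_min hex (by omega)
  have h3 := hk₀ k (by omega)
  have h4 : (2 : ℝ) ^ k < M * R := by exact_mod_cast not_le.1 hmin
  have h5 : (0 : ℝ) < 2 ^ k := by positivity
  have h6 : (M : ℝ) * (A * k + A + B) < 2 ^ k := by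
    have : (M : ℝ) * A * ((k : ℝ) ^ 1 / 2 ^ k) + M * (A + B) * ((k : ℝ) ^ 0 / 2 ^ k)
        = (M : ℝ) * (A * k + A + B) / 2 ^ k := by ring
    rw [this, div_lt_one h5] at h3
    exact h3
  rw [hk]
  push_cast
  have h7 : (M : ℝ) * (A * k + A + B) < M * R := h6.trans h4
  have := lt_of_mul_lt_mul_left h7 (by positivity)
  linarith

theorem exists_last {P : ℕ → Prop} (h0 : P 0) (N : ℕ) :
    ∃ t ≤ N, P t ∧ (t = N ∨ ¬ P (t + 1)) := by
  induction N with
  | zero => exact ⟨0, le_rfl, h0, Or.inl rfl⟩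
  | succ N ih =>
    obtain ⟨t, ht, hP, rfl | h⟩ := ih
    · by_cases h : P (t + 1)
      · exact ⟨t + 1, le_rfl, h, Or.inl rfl⟩
      · exact ⟨t, by omega, hP, Or.inr h⟩
    · exact ⟨t, by omega, hP, Or.inr h⟩

/-- Points on a geodesic of `Γ₀` are uniformly close to every geodesic of `Γ` with the same
end points. -/
theorem FourPoint.exists_isGeodesic_close {δ : ℝ} (h : FourPoint Γ₀ δ) (h₀ : Γ₀.Connected)
    (hδ : 0 ≤ δ) {L : ℕ} (hL : ∀ x y, Γ₀.dist x y ≤ L * Γ.dist x y)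
    (hL' : ∀ x y, Γ.dist x y ≤ L * Γ₀.dist x y) :
    ∃ D : ℝ, 0 ≤ D ∧ ∀ (z : ℕ → V) (n : ℕ) (c : ℕ → V) (N : ℕ), IsGeodesic Γ z n →
      IsGeodesic Γ₀ c N → c 0 = z 0 → c N = z n → ∀ t ≤ N, ∃ i ≤ n,
        (Γ₀.dist (c t) (z i) : ℝ) ≤ D := by
  obtain ⟨D, hD⟩ := exists_log_bound δ (2 * δ + L) (6 * L + 1) (by omega)
  refine ⟨max D (2 * δ), le_max_of_le_right (by linarith), ?_⟩
  intro z n c N hz hc hc0 hcN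
  have hmin : ∀ t, ∃ i ≤ n, ∀ j ≤ n, Γ₀.dist (c t) (z i) ≤ Γ₀.dist (c t) (z j) := by
    intro t
    obtain ⟨i, hi, hle⟩ := (Finset.range (n + 1)).exists_min_image (fun i => Γ₀.dist (c t) (z i))
      ⟨0, by simp⟩
    simp only [Finset.mem_range, Nat.lt_succ_iff] at hi hle
    exact ⟨i, hi, hle⟩
  -- `z (f t)` is a nearest point of the path to `c t`. Below, `t₀` maximises this distance and `R`
  -- is the maximum.
  choose f hfn hf using hmin
  obtain ⟨t₀, ht₀, hmax⟩ := (Finset.range (N + 1)).exists_max_image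
    (fun t => Γ₀.dist (c t) (z (f t))) ⟨0, by simp⟩
  simp only [Finset.mem_range, Nat.lt_succ_iff] at ht₀ hmax
  obtain ⟨R, hR⟩ : ∃ R, Γ₀.dist (c t₀) (z (f t₀)) = R := ⟨_, rfl⟩
  rw [hR] at hmax
  have hfar : ∀ i ≤ n, (R : ℝ) ≤ Γ₀.dist (z i) (c t₀) := by
    intro i hi
    have := hf t₀ i hi
    rw [Γ₀.dist_comm]
    exact_mod_cast hR ▸ this
  suffices hRD : (R : ℝ) ≤ max D (2 * δ) by
    intro t ht
    refine ⟨f t, hfn t, le_trans ?_ hRD⟩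
    exact_mod_cast hmax t ht
  by_contra! hcon
  obtain ⟨hRD, hRδ⟩ := max_lt_iff.1 hcon
  obtain ⟨k, hk, hkR⟩ := hD R hRD
  -- Step back `2R` along `c`, or to its end, and project to the path. Seen from `c t₀`, the
  -- projection lies in the same direction as `c a`. The point `b` is the mirror image.
  obtain ⟨a, ha, i, hi, hdi, hgi, hta⟩ : ∃ a ≤ t₀, ∃ i ≤ n, Γ₀.dist (c a) (z i) ≤ R ∧
      (R : ℝ) ≤ gromovProduct Γ₀ (c t₀) (c a) (z i) ∧ t₀ ≤ a + 2 * R := by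
    by_cases hcase : t₀ ≤ 2 * R
    · refine ⟨0, by omega, 0, by omega, by simp [hc0], ?_, by omega⟩
      rw [hc0, gromovProduct_self]
      exact hfar 0 (by omega)
    · have hle := hmax (t₀ - 2 * R) (by omega)
      refine ⟨t₀ - 2 * R, by omega, f (t₀ - 2 * R), hfn _, hle, ?_, by omega⟩
      have h1 := hfar _ (hfn (t₀ - 2 * R))
      have h2 := hc.dist_eq_sub (show t₀ - 2 * R ≤ t₀ by omega) ht₀
      rw [Nat.cast_sub (by omega)] at h2
      push_cast at h2
      have h3 : (Γ₀.dist (c (t₀ - 2 * R)) (z (f (t₀ - 2 * R))) : ℝ) ≤ R := by exact_mod_cast hle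
      unfold gromovProduct
      linarith
  obtain ⟨b, hb, hbN, j, hj, hdj, hgj, htb⟩ : ∃ b, t₀ ≤ b ∧ b ≤ N ∧ ∃ j ≤ n,
      Γ₀.dist (c b) (z j) ≤ R ∧
      (R : ℝ) ≤ gromovProduct Γ₀ (c t₀) (c b) (z j) ∧ b ≤ t₀ + 2 * R := by
    by_cases hcase : N ≤ t₀ + 2 * R
    · refine ⟨N, ht₀, le_rfl, n, le_rfl, by simp [hcN], ?_, hcase⟩
      rw [hcN, gromovProduct_self]
      exact hfar n le_rfl
    · have hle := hmax (t₀ + 2 * R) (by omega)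
      refine ⟨t₀ + 2 * R, by omega, by omega, f (t₀ + 2 * R), hfn _, hle, ?_, by omega⟩
      have h1 := hfar _ (hfn (t₀ + 2 * R))
      have h2 := hc.dist_eq_sub (show t₀ ≤ t₀ + 2 * R by omega) (by omega)
      rw [dist_comm_real] at h2
      push_cast at h2
      have h3 : (Γ₀.dist (c (t₀ + 2 * R)) (z (f (t₀ + 2 * R))) : ℝ) ≤ R := by exact_mod_cast hle
      unfold gromovProduct
      linarith
  have hprod : gromovProduct Γ₀ (c t₀) (z i) (z j) ≤ 2 * δ := by
    have h1 := hc.gromovProduct_eq_zero ha hb hbN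
    rcases h.cases (c t₀) (c a) (z i) (c b) with e | e
    · linarith
    · rcases h.cases (c t₀) (z i) (z j) (c b) with e' | e'
      · linarith
      · rw [gromovProduct_comm] at e'
        linarith
  -- The piece of `z` between the projections has length linear in `R`, so it passes within `O(log
  -- R)` of `c t₀`, against `hfar`.
  have hd : Γ₀.dist (z i) (z j) ≤ 6 * R := by
    have h1 : Γ₀.dist (z i) (z j) ≤ Γ₀.dist (z i) (c a) + Γ₀.dist (c a) (z j) := h₀.dist_triangle
    have h2 : Γ₀.dist (c a) (z j) ≤ Γ₀.dist (c a) (c b) + Γ₀.dist (c b) (z j) := h₀.dist_triangle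
    have h3 := hc a b (by omega) hbN
    rw [Γ₀.dist_comm] at h1
    have := Γ₀.dist_comm (u := z i) (v := c a)
    have := Γ₀.dist_comm (u := z i) (v := z j)
    omega
  have hdΓ : Γ.dist (z i) (z j) ≤ 2 ^ k := by
    have := hL' (z i) (z j)
    have : L * Γ₀.dist (z i) (z j) ≤ L * (6 * R) := Nat.mul_le_mul_left _ hd
    have : L * (6 * R) ≤ (6 * L + 1) * R := by nlinarith
    omega
  have hstep : ∀ i < n, Γ₀.dist (z i) (z (i + 1)) ≤ L := by
    intro i hi
    have := hL (z i) (z (i + 1))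
    rw [hz i (i + 1) (by omega) (by omega)] at this
    simpa using this
  obtain ⟨m, hm, hdm⟩ : ∃ m ≤ n, (Γ₀.dist (c t₀) (z m) : ℝ) ≤ 2 * δ + k * δ + L := by
    rcases le_total i j with hij | hij
    · rw [hz i j hij hj] at hdΓ
      obtain ⟨m, hm, h1⟩ := h.exists_dist_le h₀ hδ hstep (c t₀) k hi hj hij hdΓ
      exact ⟨m, hm, by linarith⟩
    · rw [Γ.dist_comm, hz j i hij hi] at hdΓ
      obtain ⟨m, hm, h1⟩ := h.exists_dist_le h₀ hδ hstep (c t₀) k hj hi hij hdΓ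
      rw [gromovProduct_comm] at h1
      exact ⟨m, hm, by linarith⟩
  have := hfar m hm
  rw [dist_comm_real] at this
  linarith

/-- Vertices on a geodesic of `Γ` are uniformly close to the geodesics of `Γ₀`. -/
theorem FourPoint.exists_gromovProduct_bound {δ : ℝ} (h : FourPoint Γ₀ δ) (h₀ : Γ₀.Connected)
    (hδ : 0 ≤ δ) {L : ℕ} (hL : ∀ x y, Γ₀.dist x y ≤ L * Γ.dist x y)
    (hL' : ∀ x y, Γ.dist x y ≤ L * Γ₀.dist x y) :
    ∃ E : ℝ, ∀ (z : ℕ → V) (n : ℕ), IsGeodesic Γ z n → ∀ m ≤ n,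
      gromovProduct Γ₀ (z m) (z 0) (z n) ≤ E := by
  obtain ⟨D, hD0, hD⟩ := h.exists_isGeodesic_close h₀ hδ hL hL'
  refine ⟨D + L * (L * (2 * D + 1)), fun z n hz m hm => ?_⟩
  obtain ⟨c, hc0, hcN, hc⟩ := exists_isGeodesic h₀ (z 0) (z n)
  set N := Γ₀.dist (z 0) (z n)
  -- At the last point of `c` close to the part of `z` before `m`, the part after `m` is close too.
  -- The indices `i ≤ m ≤ j` are then boundedly far apart, so `z m` is trapped near `c t`.
  obtain ⟨t, ht, ⟨i, hi, hdi⟩, hlast⟩ := exists_last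
    (P := fun t => ∃ i ≤ m, (Γ₀.dist (c t) (z i) : ℝ) ≤ D) ⟨0, by omega, by simpa [hc0]⟩ N
  obtain ⟨j, hmj, hj, hdj⟩ : ∃ j, m ≤ j ∧ j ≤ n ∧ (Γ₀.dist (c t) (z j) : ℝ) ≤ D + 1 := by
    rcases hlast with rfl | hlast
    · exact ⟨n, hm, le_rfl, by rw [hcN]; simp; linarith⟩
    · by_cases htN : t = N
      · exact ⟨n, hm, le_rfl, by rw [htN, hcN]; simp; linarith⟩
      obtain ⟨j, hj, hdj⟩ := hD z n c N hz hc hc0 hcN (t + 1) (by omega)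
      refine ⟨j, ?_, hj, ?_⟩
      · by_contra! hlt
        exact hlast ⟨j, hlt.le, hdj⟩
      · have h1 := dist_triangle_real h₀ (c t) (c (t + 1)) (z j)
        have h2 := hc.dist_eq_sub (show t ≤ t + 1 by omega) (by omega)
        push_cast at h2
        linarith
  have h1 : (Γ₀.dist (z i) (z j) : ℝ) ≤ 2 * D + 1 := by
    have := dist_triangle_real h₀ (z i) (c t) (z j)
    rw [dist_comm_real Γ₀ (z i) (c t)] at this
    linarith
  have h2 : ((j : ℝ) - i) ≤ L * (2 * D + 1) := by
    rw [← hz.dist_eq_sub (hi.trans hmj) hj]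
    have : (Γ.dist (z i) (z j) : ℝ) ≤ L * Γ₀.dist (z i) (z j) := by exact_mod_cast hL' _ _
    exact this.trans (by gcongr)
  have h3 : (Γ₀.dist (z m) (z i) : ℝ) ≤ L * (L * (2 * D + 1)) := by
    have h4 : (Γ₀.dist (z i) (z m) : ℝ) ≤ L * Γ.dist (z i) (z m) := by exact_mod_cast hL _ _
    rw [dist_comm_real]
    rw [hz.dist_eq_sub hi hm] at h4
    refine h4.trans (mul_le_mul_of_nonneg_left ?_ (by positivity))
    have : (m : ℝ) ≤ j := by exact_mod_cast hmj
    linarith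
  have h5 := gromovProduct_le_add_dist h₀ (z m) (c t) (z 0) (z n)
  have h6 := hc.gromovProduct_eq_zero (Nat.zero_le t) ht le_rfl
  rw [hc0, hcN] at h6
  have h7 := dist_triangle_real h₀ (z m) (z i) (c t)
  rw [dist_comm_real Γ₀ (z i) (c t)] at h7
  linarith

theorem FourPoint.exists_dist_le_of_gromovProduct_le {δ : ℝ} (h : FourPoint Γ δ) (hΓ : Γ.Connected)
    (hδ : 0 ≤ δ) {c : ℕ → V} {N : ℕ} (hc : IsGeodesic Γ c N) {p : V} {E : ℝ}
    (hp : gromovProduct Γ p (c 0) (c N) ≤ E) :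
    ∃ t ≤ N, (Γ.dist p (c t) : ℝ) ≤ 2 * E + 2 * δ := by
  have hN := hc.dist_eq_sub (Nat.zero_le N) le_rfl
  have hE := (gromovProduct_nonneg hΓ p (c 0) (c N)).trans hp
  have tri := dist_triangle_real hΓ (c 0) p (c N)
  have e1 := dist_comm_real Γ p (c N)
  simp only [Nat.cast_zero, sub_zero] at hN
  rcases le_total (Γ.dist (c 0) p) N with hle | hle
  · refine ⟨_, hle, ?_⟩
    set t := Γ.dist (c 0) p with ht
    have h1 := hc.dist_eq_sub (Nat.zero_le t) hle
    have h2 := hc.dist_eq_sub hle le_rfl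
    have h3 := h.cases p (c 0) (c t) (c N)
    have e2 := dist_comm_real Γ p (c t)
    simp only [Nat.cast_zero, sub_zero] at h1
    unfold gromovProduct at *
    rw [← ht] at *
    rcases h3 with h3 | h3 <;> linarith
  · refine ⟨N, le_rfl, ?_⟩
    have : (N : ℝ) ≤ Γ.dist (c 0) p := by exact_mod_cast hle
    unfold gromovProduct at hp
    linarith

/-- Thin triangles imply the four point inequality. -/
theorem fourPoint_of_thin (hΓ : Γ.Connected) {C : ℝ} (hC : 0 ≤ C)
    (hthin : ∀ (c : ℕ → V) (n : ℕ), IsGeodesic Γ c n → ∀ t ≤ n, ∀ y,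
      gromovProduct Γ (c t) (c 0) y ≤ C ∨ gromovProduct Γ (c t) y (c n) ≤ C) :
    FourPoint Γ (3 * C + 1) := by
  intro w x y z
  obtain ⟨c, hc0, hcN, hc⟩ := exists_isGeodesic hΓ x z
  set N := Γ.dist x z
  -- The chosen `c t` is near both sides at `w`, so its distance to `w` is at most `(x | z)_w + 2C +
  -- 1`. Moving the base point to `w` then adds the remaining `C`.
  obtain ⟨t, ht, hP, hlast⟩ := exists_last (P := fun t => gromovProduct Γ (c t) x w ≤ C)
    (by simpa [hc0, gromovProduct, Γ.dist_comm] using hC) N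
  have hw : gromovProduct Γ (c t) w z ≤ C + 1 := by
    by_cases htN : t = N
    · rw [htN, hcN]
      have : gromovProduct Γ z w z = 0 := by simp [gromovProduct]
      linarith
    · have h1 := hthin c N hc (t + 1) (by omega) w
      rw [hc0, hcN] at h1
      have h2 := h1.resolve_left (hlast.resolve_left htN)
      have h3 := gromovProduct_le_add_dist hΓ (c t) (c (t + 1)) w z
      have h4 := hc.dist_eq_sub (show t ≤ t + 1 by omega) (by omega)
      push_cast at h4
      linarith
  have h0 := hc.gromovProduct_eq_zero (Nat.zero_le t) ht le_rfl
  have h1 := hthin c N hc t ht y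
  rw [hc0, hcN] at h0 h1
  have e1 := dist_comm_real Γ w (c t)
  have e2 := dist_comm_real Γ w z
  have e3 := dist_comm_real Γ w x
  have hd : (Γ.dist w (c t) : ℝ) ≤ gromovProduct Γ w x z + 2 * C + 1 := by
    unfold gromovProduct at *
    linarith
  rcases h1 with h1 | h1
  · have := gromovProduct_le_add_dist hΓ w (c t) x y
    have := min_le_left (gromovProduct Γ w x y) (gromovProduct Γ w y z)
    linarith
  · have := gromovProduct_le_add_dist hΓ w (c t) y z
    have := min_le_right (gromovProduct Γ w x y) (gromovProduct Γ w y z)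
    linarith

/-- Gromov hyperbolicity is invariant under bilipschitz changes of the graph metric. -/
theorem IsGromovHyperbolic.of_bilipschitz (h : IsGromovHyperbolic Γ₀) (hΓ : Γ.Connected) {L : ℕ}
    (hL : ∀ x y, Γ₀.dist x y ≤ L * Γ.dist x y) (hL' : ∀ x y, Γ.dist x y ≤ L * Γ₀.dist x y) :
    IsGromovHyperbolic Γ := by
  have h₀ := h.1
  obtain ⟨δ, hδ, h⟩ := h.exists_fourPoint
  obtain ⟨D, hD0, hD⟩ := h.exists_isGeodesic_close h₀ hδ hL hL'
  obtain ⟨E, hE⟩ := h.exists_gromovProduct_bound h₀ hδ hL hL'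
  -- A small `Γ₀`-product puts `p` near a `Γ₀`-geodesic, hence near a `Γ`-geodesic, where the
  -- `Γ`-product is small.
  have hclose : ∀ x y p : V, gromovProduct Γ₀ p x y ≤ E + δ →
      gromovProduct Γ p x y ≤ L * (2 * (E + δ) + 2 * δ + D) := by
    intro x y p hp
    obtain ⟨z, hz0, hzn, hz⟩ := exists_isGeodesic hΓ x y
    obtain ⟨c, hc0, hcN, hc⟩ := exists_isGeodesic h₀ x y
    have hp' : gromovProduct Γ₀ p (c 0) (c (Γ₀.dist x y)) ≤ E + δ := by rwa [hc0, hcN]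
    obtain ⟨t, ht, hpt⟩ := h.exists_dist_le_of_gromovProduct_le h₀ hδ hc hp'
    obtain ⟨i, hi, hti⟩ := hD z _ c _ hz hc (by rw [hc0, hz0]) (by rw [hcN, hzn]) t ht
    have h1 := dist_triangle_real h₀ p (c t) (z i)
    have h2 : (Γ.dist p (z i) : ℝ) ≤ L * Γ₀.dist p (z i) := by exact_mod_cast hL' _ _
    have h3 : (L : ℝ) * Γ₀.dist p (z i) ≤ L * (2 * (E + δ) + 2 * δ + D) :=
      mul_le_mul_of_nonneg_left (by linarith) (by positivity)
    have h4 := gromovProduct_le_add_dist hΓ p (z i) x y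
    have h5 := hz.gromovProduct_eq_zero (Nat.zero_le i) hi le_rfl
    rw [hz0, hzn] at h5
    linarith
  have hE0 : 0 ≤ E := by
    obtain ⟨v⟩ := hΓ.nonempty
    exact (gromovProduct_nonneg h₀ _ _ _).trans
      (hE (fun _ => v) 0 (fun i j _ _ => by simp; omega) 0 le_rfl)
  refine ⟨hΓ, _, fourPoint_of_thin hΓ (C := L * (2 * (E + δ) + 2 * δ + D)) (by positivity) ?_⟩
  intro c n hc t ht y
  have h1 := hE c n hc t ht
  rcases h.cases (c t) (c 0) y (c n) with e | e
  · exact Or.inl (hclose _ _ _ (by linarith))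
  · exact Or.inr (hclose _ _ _ (by linarith))

end Graph

/-! ### Cayley graphs and change of generators -/

section Cayley

variable {H : Type*} [Group H]

theorem mulCayley_connected {S : Set H} (hgen : Subgroup.closure S = ⊤) :
    (SimpleGraph.mulCayley S).Connected := by
  have key : ∀ x : H, (SimpleGraph.mulCayley S).Reachable 1 x := by
    intro x
    have hx : x ∈ Subgroup.closure S := by rw [hgen]; trivial
    induction hx using Subgroup.closure_induction_right with
    | one => exact .refl _
    | mul_right x hx s hs ih =>
      refine ih.trans ?_
      by_cases h : x = x * s
      · rw [← h]
      · exact SimpleGraph.Adj.reachable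
          ((SimpleGraph.mulCayley_adj S _ _).2 ⟨h, Or.inl (by simpa using hs)⟩)
    | mul_inv_cancel x hx s hs ih =>
      refine ih.trans ?_
      by_cases h : x = x * s⁻¹
      · rw [← h]
      · exact SimpleGraph.Adj.reachable
          ((SimpleGraph.mulCayley_adj S _ _).2 ⟨h, Or.inr (by simpa using hs)⟩)
  exact ⟨fun x y => (key x).symm.trans (key y)⟩

/-- Left translations preserve the path metric of the graph. -/
def IsLeftInvariant (Γ : SimpleGraph H) : Prop :=
  ∀ g x y : H, Γ.dist (g * x) (g * y) = Γ.dist x y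

theorem isLeftInvariant_mulCayley {S : Set H} (hgen : Subgroup.closure S = ⊤) :
    IsLeftInvariant (SimpleGraph.mulCayley S) := by
  have key : ∀ g x y : H, (SimpleGraph.mulCayley S).dist (g * x) (g * y) ≤
      (SimpleGraph.mulCayley S).dist x y := by
    intro g x y
    obtain ⟨p, hp⟩ := (mulCayley_connected hgen).exists_walk_length_eq_dist x y
    let f : SimpleGraph.mulCayley S →g SimpleGraph.mulCayley S :=
      ⟨fun x => g * x, fun h => SimpleGraph.mulCayley_adj_mul_iff_right.2 h⟩
    rw [← hp, ← SimpleGraph.Walk.length_map f p]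
    exact SimpleGraph.dist_le (p.map f)
  intro g x y
  refine le_antisymm (key g x y) ?_
  simpa using key g⁻¹ (g * x) (g * y)

/-- Balls around `1` are finite. -/
def HasFiniteBalls (Γ : SimpleGraph H) : Prop :=
  ∀ r : ℕ, {x : H | Γ.dist x 1 ≤ r}.Finite

theorem hasFiniteBalls_mulCayley {S : Set H} (hfin : S.Finite)
    (hgen : Subgroup.closure S = ⊤) : HasFiniteBalls (SimpleGraph.mulCayley S) := by
  have hconn := mulCayley_connected hgen
  intro r
  induction r with
  | zero =>
    refine (Set.finite_singleton (1 : H)).subset fun x hx => ?_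
    simpa [hconn.dist_eq_zero_iff] using hx
  | succ r ih =>
    refine (ih.union (Set.Finite.image2 (fun a b => a * b) ih
      (hfin.union hfin.inv))).subset fun x hx => ?_
    by_cases hxr : (SimpleGraph.mulCayley S).dist x 1 ≤ r
    · exact Or.inl hxr
    · have hd : (SimpleGraph.mulCayley S).dist 1 x = r + 1 := by
        rw [SimpleGraph.dist_comm]
        exact le_antisymm hx (by omega)
      obtain ⟨c, h0, hn, hc⟩ := exists_isGeodesic hconn 1 x
      rw [hd] at hn hc
      have h1 := hc 0 r (by omega) (by omega)
      have h2 := hc r (r + 1) (by omega) (by omega)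
      rw [hn, Nat.add_sub_cancel_left, SimpleGraph.dist_eq_one_iff_adj,
        SimpleGraph.mulCayley_adj] at h2
      rw [h0, SimpleGraph.dist_comm] at h1
      refine Or.inr ⟨c r, h1.le, (c r)⁻¹ * x, ?_, by simp⟩
      rcases h2.2 with h | h
      · exact Or.inl h
      · exact Or.inr (by simpa using h)

theorem exists_dist_mulCayley_le_mul {S S₀ : Set H} (hfin : S.Finite)
    (hgen : Subgroup.closure S = ⊤) (hgen₀ : Subgroup.closure S₀ = ⊤) :
    ∃ L : ℕ, ∀ x y, (SimpleGraph.mulCayley S₀).dist x y ≤ L * (SimpleGraph.mulCayley S).dist x y := by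
  obtain ⟨L, hL⟩ := (hfin.image fun s => (SimpleGraph.mulCayley S₀).dist 1 s).bddAbove
  have hL' : ∀ s ∈ S, (SimpleGraph.mulCayley S₀).dist 1 s ≤ L := fun s hs =>
    hL (Set.mem_image_of_mem _ hs)
  have hinv := isLeftInvariant_mulCayley hgen₀
  refine ⟨L, dist_le_mul_of_adj (mulCayley_connected hgen₀) (mulCayley_connected hgen) ?_⟩
  intro x y hxy
  rcases ((SimpleGraph.mulCayley_adj S x y).1 hxy).2 with h | h
  · have := hL' _ h
    rwa [← hinv x, mul_one, mul_inv_cancel_left] at this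
  · have := hL' _ h
    rwa [← hinv y, mul_one, mul_inv_cancel_left, SimpleGraph.dist_comm] at this

/-- The Cayley graph of a word hyperbolic group with respect to any finite generating set is
Gromov hyperbolic. -/
theorem IsWordHyperbolic.isGromovHyperbolic (hH : IsWordHyperbolic H) {S : Set H}
    (hfin : S.Finite) (hgen : Subgroup.closure S = ⊤) :
    IsGromovHyperbolic (SimpleGraph.mulCayley S) := by
  obtain ⟨S₀, hfin₀, hgen₀, h⟩ := hH
  obtain ⟨L, hL⟩ := exists_dist_mulCayley_le_mul hfin hgen hgen₀
  obtain ⟨L', hL'⟩ := exists_dist_mulCayley_le_mul hfin₀ hgen₀ hgen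
  exact h.of_bilipschitz (mulCayley_connected hgen) (L := max L L')
    (fun x y => (hL x y).trans (Nat.mul_le_mul_right _ (le_max_left _ _)))
    (fun x y => (hL' x y).trans (Nat.mul_le_mul_right _ (le_max_right _ _)))

end Cayley

/-! ### Loxodromic elements in infinite subgroups -/

section Loxodromic

variable {H : Type*} [Group H] {Γ : SimpleGraph H}

theorem IsLeftInvariant.dist_mul_left (hinv : IsLeftInvariant Γ) (g x : H) :
    Γ.dist (g * x) g = Γ.dist x 1 := by
  simpa using hinv g x 1

theorem IsLeftInvariant.dist_inv_one (hinv : IsLeftInvariant Γ) (g : H) :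
    Γ.dist g⁻¹ 1 = Γ.dist g 1 := by
  rw [← hinv g, mul_inv_cancel, mul_one, Γ.dist_comm]

theorem IsLeftInvariant.dist_inv_left (hinv : IsLeftInvariant Γ) (g x : H) :
    Γ.dist g⁻¹ x = Γ.dist (g * x) 1 := by
  rw [← hinv g, mul_inv_cancel, Γ.dist_comm]

theorem IsLeftInvariant.gromovProduct_mul_left (hinv : IsLeftInvariant Γ) (g x : H) :
    gromovProduct Γ 1 (g * x) g = Γ.dist g 1 - gromovProduct Γ 1 g⁻¹ x := by
  unfold gromovProduct
  rw [hinv.dist_mul_left, hinv.dist_inv_one, hinv.dist_inv_left]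
  ring

/-- The geodesic from `1` to `q` does not fold back onto the geodesic from `1` to `q⁻¹`. -/
def IsLoxodromic (Γ : SimpleGraph H) (δ : ℝ) (q : H) : Prop :=
  2 * gromovProduct Γ 1 q q⁻¹ + 3 * δ < Γ.dist q 1

theorem IsLoxodromic.inv (hinv : IsLeftInvariant Γ) {δ : ℝ} {q : H} (hq : IsLoxodromic Γ δ q) :
    IsLoxodromic Γ δ q⁻¹ := by
  unfold IsLoxodromic at *
  rwa [inv_inv, gromovProduct_comm, hinv.dist_inv_one]

/-- The two bounds feed each other: little overlap of `q ^ n` with `q⁻¹` becomes, after translation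
by `q`, large overlap of `q ^ (n + 1)` with `q`. By loxodromicity this exceeds `(q | q⁻¹) + δ`,
which forces little overlap with `q⁻¹` again. -/
theorem IsLoxodromic.gromovProduct_pow (hinv : IsLeftInvariant Γ) {δ : ℝ} (h : FourPoint Γ δ)
    (hΓ : Γ.Connected) (hδ : 0 ≤ δ) {q : H} (hq : IsLoxodromic Γ δ q) (n : ℕ) :
    gromovProduct Γ 1 (q ^ (n + 1)) q⁻¹ ≤ gromovProduct Γ 1 q q⁻¹ + δ ∧
      Γ.dist q 1 - gromovProduct Γ 1 q q⁻¹ - δ ≤ gromovProduct Γ 1 (q ^ (n + 1)) q := by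
  unfold IsLoxodromic at hq
  have h0 := gromovProduct_nonneg hΓ 1 q q⁻¹
  induction n with
  | zero =>
    rw [zero_add, pow_one, gromovProduct_self]
    constructor <;> linarith
  | succ n ih =>
    have h1 := hinv.gromovProduct_mul_left q (q ^ (n + 1))
    rw [← pow_succ', gromovProduct_comm 1 q⁻¹] at h1
    refine ⟨?_, by linarith [ih.1]⟩
    rcases h.cases 1 q (q ^ (n + 1 + 1)) q⁻¹ with e | e
    · rw [gromovProduct_comm] at e
      linarith [ih.1]
    · exact e

theorem IsLoxodromic.gromovProduct_pow_inv_pow_le (hinv : IsLeftInvariant Γ) {δ : ℝ}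
    (h : FourPoint Γ δ) (hΓ : Γ.Connected) (hδ : 0 ≤ δ) {q : H} (hq : IsLoxodromic Γ δ q) {m n : ℕ}
    (hm : 0 < m) (hn : 0 < n) :
    gromovProduct Γ 1 (q ^ m) (q⁻¹ ^ n) ≤ gromovProduct Γ 1 q q⁻¹ + 2 * δ := by
  obtain ⟨m, rfl⟩ := Nat.exists_eq_succ_of_ne_zero hm.ne'
  obtain ⟨n, rfl⟩ := Nat.exists_eq_succ_of_ne_zero hn.ne'
  have h1 := (hq.gromovProduct_pow hinv h hΓ hδ m).1
  have h2 := ((hq.inv hinv).gromovProduct_pow hinv h hΓ hδ n).2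
  rw [inv_inv, hinv.dist_inv_one, gromovProduct_comm 1 q⁻¹ q] at h2
  unfold IsLoxodromic at hq
  simp only [Nat.succ_eq_add_one]
  by_contra! hcon
  rcases h.cases 1 (q ^ (m + 1)) (q⁻¹ ^ (n + 1)) q⁻¹ with e | e <;> linarith

theorem IsLoxodromic.injective_pow (hinv : IsLeftInvariant Γ) {δ : ℝ} (h : FourPoint Γ δ)
    (hΓ : Γ.Connected) (hδ : 0 ≤ δ) {q : H} (hq : IsLoxodromic Γ δ q) :
    Function.Injective fun n : ℕ => q ^ n := by
  rw [injective_pow_iff_not_isOfFinOrder, isOfFinOrder_iff_pow_eq_one]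
  rintro ⟨n, hn, h1⟩
  obtain ⟨n, rfl⟩ := Nat.exists_eq_succ_of_ne_zero hn.ne'
  have h2 := (hq.gromovProduct_pow hinv h hΓ hδ n).2
  rw [Nat.succ_eq_add_one] at h1
  have h3 : gromovProduct Γ 1 1 q = 0 := by simp [gromovProduct, Γ.dist_comm]
  have h0 := gromovProduct_nonneg hΓ 1 q q⁻¹
  rw [h1, h3] at h2
  unfold IsLoxodromic at hq
  linarith

/-- Ping-pong: geodesics to non-loxodromic `q` and `q⁻¹` agree for about half their length. If `q`
and `p` separated earlier, `q * p` would be loxodromic. -/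
theorem le_gromovProduct_of_forall_not_isLoxodromic (hinv : IsLeftInvariant Γ) {δ : ℝ}
    (h : FourPoint Γ δ) (hδ : 0 ≤ δ) {Q : Subgroup H} (hQ : ∀ q ∈ Q, ¬ IsLoxodromic Γ δ q)
    {q p : H} (hq : q ∈ Q) (hp : p ∈ Q) :
    (Γ.dist q 1 : ℝ) / 2 - 3 * δ ≤ gromovProduct Γ 1 q p ∨
      (Γ.dist p 1 : ℝ) / 2 - 3 * δ ≤ gromovProduct Γ 1 q p := by
  by_contra! hcon
  obtain ⟨h1, h2⟩ := hcon
  have hlq := not_lt.1 (hQ q hq)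
  have hlp := not_lt.1 (hQ p hp)
  have hlu := not_lt.1 (hQ _ (mul_mem hq hp))
  have a1 : gromovProduct Γ 1 q⁻¹ p ≤ gromovProduct Γ 1 q p + δ :=
    (h.cases 1 q q⁻¹ p).resolve_left (by linarith)
  have a2 : gromovProduct Γ 1 q p⁻¹ ≤ gromovProduct Γ 1 q p + δ := by
    refine (h.cases 1 q p⁻¹ p).resolve_right ?_
    rw [gromovProduct_comm]
    linarith
  have b1 := hinv.gromovProduct_mul_left q p
  have b2 := hinv.gromovProduct_mul_left p⁻¹ q⁻¹
  rw [← mul_inv_rev, inv_inv, hinv.dist_inv_one, gromovProduct_comm 1 p] at b2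
  have b3 : gromovProduct Γ 1 (q * p) (q * p)⁻¹ ≤ gromovProduct Γ 1 q p + 3 * δ := by
    have c1 := (h.cases 1 q (q * p) p⁻¹).resolve_left (by
      rw [gromovProduct_comm 1 q]; linarith)
    have c2 := (h.cases 1 (q * p) (q * p)⁻¹ p⁻¹).resolve_right (by linarith)
    linarith
  have b4 : (Γ.dist (q * p) 1 : ℝ) = Γ.dist q 1 + Γ.dist p 1 - 2 * gromovProduct Γ 1 q⁻¹ p := by
    unfold gromovProduct
    rw [hinv.dist_inv_one, hinv.dist_inv_left]
    ring
  linarith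

/-- By the previous lemma `(q⁻¹ | p)` is within `3δ` of `|q| / 2`, so `q` hardly shifts points along
the geodesic to `p`; and `p`, `q * p` agree up to length `|x|`. Thus `x` and `q * x` lie at nearly
the same height on nearly the same geodesic. -/
theorem dist_mul_le_of_forall_not_isLoxodromic (hinv : IsLeftInvariant Γ) {δ : ℝ}
    (h : FourPoint Γ δ) (hΓ : Γ.Connected) (hδ : 0 ≤ δ) {Q : Subgroup H}
    (hQ : ∀ q ∈ Q, ¬ IsLoxodromic Γ δ q) {q p x : H} (hq : q ∈ Q) (hp : p ∈ Q)
    (ht : Γ.dist q 1 + 4 * δ < Γ.dist x 1)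
    (hpt : 2 * Γ.dist x 1 + Γ.dist q 1 + 6 * δ ≤ Γ.dist p 1)
    (hx : (Γ.dist x 1 + Γ.dist x p : ℝ) = Γ.dist p 1) :
    (Γ.dist x (q * x) : ℝ) ≤ 26 * δ := by
  have hq0 : (0 : ℝ) ≤ Γ.dist q 1 := by positivity
  have e1 : (Γ.dist q⁻¹ p : ℝ) = Γ.dist (q * p) 1 := by rw [hinv.dist_inv_left]
  have e2 : (Γ.dist q⁻¹ x : ℝ) = Γ.dist (q * x) 1 := by rw [hinv.dist_inv_left]
  have e3 : (Γ.dist q⁻¹ 1 : ℝ) = Γ.dist q 1 := by rw [hinv.dist_inv_one]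
  have e4 : (Γ.dist (q * p) (q * x) : ℝ) = Γ.dist x p := by rw [hinv, Γ.dist_comm]
  have e5 := dist_comm_real Γ p x
  have e6 : (Γ.dist p 1 : ℝ) ≤ Γ.dist q 1 + Γ.dist (q * p) 1 := by
    have := dist_triangle_real hΓ p q⁻¹ 1
    rw [dist_comm_real Γ p q⁻¹, e1, e3] at this
    linarith
  have b1 := hinv.gromovProduct_mul_left q p
  have f1 : (Γ.dist q 1 : ℝ) / 2 - 3 * δ ≤ gromovProduct Γ 1 q⁻¹ p := by
    have := le_gromovProduct_of_forall_not_isLoxodromic hinv h hδ hQ (inv_mem hq) hp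
    rw [e3] at this
    rcases this with this | this <;> linarith
  have f2 : gromovProduct Γ 1 q⁻¹ p ≤ (Γ.dist q 1 : ℝ) / 2 + 3 * δ := by
    have := le_gromovProduct_of_forall_not_isLoxodromic hinv h hδ hQ (mul_mem hq hp) hq
    rcases this with this | this <;> linarith
  have f3 : (Γ.dist x 1 : ℝ) ≤ gromovProduct Γ 1 p (q * p) := by
    have := le_gromovProduct_of_forall_not_isLoxodromic hinv h hδ hQ hp (mul_mem hq hp)
    rcases this with this | this <;> linarith
  have f4 : gromovProduct Γ 1 x p = Γ.dist x 1 := by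
    unfold gromovProduct
    linarith
  have g1 : (Γ.dist q 1 : ℝ) / 2 - 4 * δ ≤ gromovProduct Γ 1 q⁻¹ x := by
    rcases h.cases 1 q⁻¹ p x with e | e
    · linarith
    · rw [gromovProduct_comm, f4] at e
      linarith
  have g2 : gromovProduct Γ 1 q⁻¹ x ≤ (Γ.dist q 1 : ℝ) / 2 + 4 * δ := by
    rcases h.cases 1 q⁻¹ x p with e | e
    · linarith
    · rw [f4] at e
      linarith
  have k1 : (Γ.dist x 1 : ℝ) - 7 * δ ≤ gromovProduct Γ 1 (q * p) (q * x) := by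
    unfold gromovProduct at *
    linarith
  have k2 : (Γ.dist x 1 : ℝ) - 9 * δ ≤ gromovProduct Γ 1 x (q * x) := by
    rcases h.cases 1 x p (q * x) with e | e
    · linarith
    · rcases h.cases 1 p (q * p) (q * x) with e' | e' <;> linarith
  unfold gromovProduct at g1 k2
  linarith

/-- An infinite subgroup contains a loxodromic element. -/
theorem exists_isLoxodromic (hinv : IsLeftInvariant Γ) (hball : HasFiniteBalls Γ) {δ : ℝ}
    (h : FourPoint Γ δ) (hΓ : Γ.Connected) (hδ : 0 ≤ δ) {Q : Subgroup H}
    (hinf : (Q : Set H).Infinite) : ∃ q ∈ Q, IsLoxodromic Γ δ q := by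
  by_contra! hQ
  -- Pigeonhole: `T` has one element more than the ball of radius `26δ`, into which `q ↦ x⁻¹ q x`
  -- would inject it.
  have hB := hball ⌊26 * δ⌋₊
  obtain ⟨T, hTQ, hT⟩ := hinf.exists_subset_card_eq (hB.toFinset.card + 1)
  obtain ⟨M, hM⟩ := (T.finite_toSet.image fun q => Γ.dist q 1).bddAbove
  have hM' : ∀ q ∈ T, Γ.dist q 1 ≤ M := fun q hq => hM (Set.mem_image_of_mem _ hq)
  obtain ⟨D, hD⟩ := exists_nat_gt (4 * δ)
  obtain ⟨p, hp, hpl⟩ := (hinf.sdiff (hball (2 * (M + D) + M + 2 * D))).nonempty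
  have hpl' : 2 * (M + D) + M + 2 * D < Γ.dist p 1 := not_le.1 hpl
  obtain ⟨c, hc0, hcN, hc⟩ := exists_isGeodesic hΓ 1 p
  rw [Γ.dist_comm] at hcN hc
  have hx1 := hc.dist_eq_sub (Nat.zero_le (M + D)) (by omega)
  have hx2 := hc.dist_eq_sub (show M + D ≤ Γ.dist p 1 by omega) le_rfl
  rw [hc0, dist_comm_real] at hx1
  rw [hcN] at hx2
  set x := c (M + D)
  push_cast at hx1 hx2
  have hmaps : ∀ q ∈ T, x⁻¹ * (q * x) ∈ hB.toFinset := by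
    intro q hq
    rw [Set.Finite.mem_toFinset]
    refine Nat.le_floor ?_
    have hqM : (Γ.dist q 1 : ℝ) ≤ M := by exact_mod_cast hM' q hq
    have hpr : (2 * (M + D) + M + 2 * D : ℝ) < Γ.dist p 1 := by exact_mod_cast hpl'
    have key := dist_mul_le_of_forall_not_isLoxodromic hinv h hΓ hδ hQ (hTQ hq) hp (x := x)
      (by linarith) (by linarith) (by linarith)
    rwa [← hinv x, mul_inv_cancel_left, mul_one, Γ.dist_comm]
  have hcard := Finset.card_le_card_of_injOn (fun q => x⁻¹ * (q * x)) hmaps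
    (fun a _ b _ hab => by simpa using hab)
  omega

end Loxodromic

/-! ### Shadowing by the quasi-normal subgroup and the limit set -/

section LimitSet

open scoped Pointwise

variable {H : Type*} [Group H] {Γ : SimpleGraph H}

theorem IsQuasiNormal.exists_conj_pow_mem {Q : Subgroup H} (hQ : IsQuasiNormal Q) (g : H) {q : H}
    (hq : q ∈ Q) : ∃ n, 0 < n ∧ g * q ^ n * g⁻¹ ∈ Q := by
  have hg : g ∈ Subgroup.Commensurable.commensurator Q := by rw [hQ]; trivial
  rw [Subgroup.Commensurable.commensurator_mem_iff] at hg
  have hmem : g * q * g⁻¹ ∈ ConjAct.toConjAct g • Q := by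
    have := Subgroup.smul_mem_pointwise_smul q (ConjAct.toConjAct g) Q hq
    rwa [ConjAct.toConjAct_smul] at this
  obtain ⟨n, hn, -, h⟩ := Subgroup.exists_pow_mem_of_relIndex_ne_zero hg.2 hmem
  rw [conj_pow] at h
  exact ⟨n, hn, h.1⟩

/-- Every vertex is uniformly close to a geodesic from `1` to an element of `Q`. -/
theorem IsQuasiNormal.exists_le_gromovProduct (hinv : IsLeftInvariant Γ) (hball : HasFiniteBalls Γ)
    {δ : ℝ} (h : FourPoint Γ δ) (hΓ : Γ.Connected) (hδ : 0 ≤ δ) {Q : Subgroup H}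
    (hQ : IsQuasiNormal Q) (hinf : (Q : Set H).Infinite) :
    ∃ B : ℝ, ∀ g : H, ∃ u ∈ Q, Γ.dist g 1 - B ≤ gromovProduct Γ 1 g u := by
  obtain ⟨q, hqQ, hq⟩ := exists_isLoxodromic hinv hball h hΓ hδ hinf
  refine ⟨gromovProduct Γ 1 q q⁻¹ + 4 * δ, fun g => ?_⟩
  have h0 := gromovProduct_nonneg hΓ 1 q q⁻¹
  obtain ⟨n, hn, hmem⟩ := hQ.exists_conj_pow_mem g hqQ
  -- The powers of `q` are distinct, so they leave every ball. Length beyond `3|g|` gives `|gr| >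
  -- 2|g|` and then `(gr | g r g⁻¹) ≥ |g|`.
  obtain ⟨k, hk0, hk⟩ : ∃ k, 0 < k ∧ 3 * Γ.dist g 1 < Γ.dist (q ^ (n * k)) 1 := by
    by_contra! hcon
    refine (Set.infinite_of_injective_forall_mem (f := fun k : ℕ => q ^ (n * (k + 1))) ?_
      fun k => hcon (k + 1) (by omega)) (hball (3 * Γ.dist g 1))
    intro a b hab
    have := hq.injective_pow hinv h hΓ hδ hab
    simpa [hn.ne'] using this
  have hmemk : g * q ^ (n * k) * g⁻¹ ∈ Q := by
    have := pow_mem hmem k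
    rwa [conj_pow, ← pow_mul] at this
  -- `g⁻¹` cannot follow both `q ^ (n * k)` and its inverse; `r` is the one it leaves early.
  obtain ⟨r, hr, hrl, hrg⟩ : ∃ r, g * r * g⁻¹ ∈ Q ∧ 3 * Γ.dist g 1 < Γ.dist r 1 ∧
      gromovProduct Γ 1 g⁻¹ r ≤ gromovProduct Γ 1 q q⁻¹ + 3 * δ := by
    have hb := hq.gromovProduct_pow_inv_pow_le hinv h hΓ hδ (Nat.mul_pos hn hk0)
      (Nat.mul_pos hn hk0)
    rcases h.cases 1 (q ^ (n * k)) g⁻¹ (q⁻¹ ^ (n * k)) with e | e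
    · exact ⟨_, hmemk, hk, by rw [gromovProduct_comm]; linarith⟩
    · refine ⟨_, ?_, ?_, by linarith⟩
      · have := inv_mem hmemk
        simpa [mul_assoc] using this
      · rwa [inv_pow, hinv.dist_inv_one]
  refine ⟨_, hr, ?_⟩
  have e1 := hinv.gromovProduct_mul_left g r
  have e2 : (Γ.dist r 1 : ℝ) ≤ Γ.dist (g * r) 1 + Γ.dist g 1 := by
    have := dist_triangle_real hΓ (g * r) 1 g
    rw [dist_comm_real Γ 1 g, hinv.dist_mul_left] at this
    exact this
  have e3 : (Γ.dist (g * r) (g * r * g⁻¹) : ℝ) = Γ.dist g 1 := by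
    rw [Γ.dist_comm, hinv.dist_mul_left, hinv.dist_inv_one]
  have e4 := dist_triangle_real hΓ (g * r) (g * r * g⁻¹) 1
  have e5 : (3 * Γ.dist g 1 : ℝ) < Γ.dist r 1 := by exact_mod_cast hrl
  have e6 : (Γ.dist g 1 : ℝ) ≤ gromovProduct Γ 1 (g * r) (g * r * g⁻¹) := by
    unfold gromovProduct
    linarith
  rw [gromovProduct_comm] at e1
  rcases h.cases 1 g (g * r) (g * r * g⁻¹) with e | e <;> linarith

theorem GromovDiverge.of_le_gromovProduct {V : Type*} {Γ : SimpleGraph V} {δ : ℝ}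
    (h : FourPoint Γ δ) {w : V} {x y : ℕ → V} (hx : GromovDiverge Γ w x x) {B : ℝ}
    (hB : ∀ n, Γ.dist (x n) w - B ≤ gromovProduct Γ w (x n) (y n)) : GromovDiverge Γ w x y := by
  unfold GromovDiverge at hx ⊢
  rw [tendsto_atTop] at hx ⊢
  intro b
  -- The second bound is used on the diagonal, where the product is the distance to `w`.
  obtain ⟨a, ha⟩ := eventually_atTop.1 ((hx (b + δ)).and (hx (b + δ + B)))
  refine eventually_atTop.2 ⟨(max a.1 a.2, max a.1 a.2), fun p hp => ?_⟩
  have h1 := (ha p ⟨(le_max_left _ _).trans hp.1, (le_max_right _ _).trans hp.2⟩).1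
  have h2 := (ha (p.2, p.2) ⟨(le_max_left _ _).trans hp.2, (le_max_right _ _).trans hp.2⟩).2
  have h3 := hB p.2
  simp only [gromovProduct_self] at h2
  rcases h.cases w (x p.1) (x p.2) (y p.2) with e | e <;> linarith

end LimitSet

end QuasiNormal

theorem theorem17 {H : Type*} [Group H] (hH : QuasiNormal.IsWordHyperbolic H)
    (Q : Subgroup H) (hQ : QuasiNormal.IsQuasiNormal Q) (hinf : (Q : Set H).Infinite)
    (S : Set H) (hfin : S.Finite) (hgen : Subgroup.closure S = ⊤) :
    QuasiNormal.limitSet (SimpleGraph.mulCayley S) 1 (Q : Set H) = Set.univ := by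
  have hyp := hH.isGromovHyperbolic hfin hgen
  obtain ⟨δ, hδ, h⟩ := hyp.exists_fourPoint
  obtain ⟨B, hB⟩ := hQ.exists_le_gromovProduct (QuasiNormal.isLeftInvariant_mulCayley hgen)
    (QuasiNormal.hasFiniteBalls_mulCayley hfin hgen) h hyp.1 hδ hinf
  refine Set.eq_univ_of_forall fun ξ => ?_
  induction ξ using Quot.ind with
  | mk x =>
    choose u huQ hu using hB
    have hxy : QuasiNormal.GromovDiverge (SimpleGraph.mulCayley S) 1 x.1 fun n => u (x.1 n) :=
      QuasiNormal.GromovDiverge.of_le_gromovProduct h x.2 fun n => hu (x.1 n)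
    exact ⟨⟨fun n => u (x.1 n), hxy.symm.trans hyp hxy⟩, fun n => huQ (x.1 n),
      Quot.sound hxy.symm⟩
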